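/- **Ramanujan's Entry II.16.12.** For complex $x, p$ with $|p|<1$ write $(x;p)_\infty=\prod_{k\ge 0}(1-xp^k)$ and $(x,y;p)_\infty=(x;p)_\infty(y;p)_\infty$. Let $a,b,q$ be complex numbers with $|q|<1$ and $|ab|<1$. Then the products $(a^2q^3,b^2q^3;q^4)_\infty$ and $(a^2q,b^2q;q^4)_\infty$ are not both zero, the continued fraction below converges in the extended complex plane $\mathbb{C}\cup\{\infty\}$, and $$ \frac{(a^2q^3,b^2q^3;q^4)_\infty}{(a^2q,b^2q;q^4)_\infty} =\frac{1}{1-ab}\genfrac{}{}{0pt}{}{}{+}\frac{(a-bq)(b-aq)}{(1-ab)(1+q^2)}\genfrac{}{}{0pt}{}{}{+}\frac{(a-bq^3)(b-aq^3)}{(1-ab)(1+q^4)}\genfrac{}{}{0pt}{}{}{+}\genfrac{}{}{0pt}{}{}{\cdots}, $$ where the left side is read as $\infty$ if its denominator is zero. Here $\frac{\alpha_1}{\beta_1}\genfrac{}{}{0pt}{}{}{+}\frac{\alpha_2}{\beta_2}\genfrac{}{}{0pt}{}{}{+}\genfrac{}{}{0pt}{}{}{\cdots}$ converges to $S\in\mathbb{C}\cup\{\infty\}$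 if $S_n(0)\to S$ in $\mathbb{C}\cup\{\infty\}$, where $S_n=s_1\circ\cdots\circ s_n$ and $s_n(w)=\alpha_n/(\beta_n+w)$ as a map of $\mathbb{C}\cup\{\infty\}$ to itself, with $s_n(\infty)=0$ and $s_n(-\beta_n)=\infty$. (If some partial numerator $\alpha_n$ vanishes, the same definition is used; the convention $s_n(-\beta_n)=\infty$ is kept.) -/

import Mathlib

open Filter Topology OnePoint

/-- The infinite `q`-rising factorial `(x; q)_∞ = ∏_{k ≥ 0} (1 - x q^k)`, used for `|q| < 1`. -/
noncomputable def qRisingInf (x q : ℂ) : ℂ := ∏' k : ℕ, (1 - x * q ^ k)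

/-- For `|q| < 1` the product defining `(x; q)_∞` converges. -/
theorem hasProd_qRisingInf (x : ℂ) {q : ℂ} (hq : ‖q‖ < 1) :
    HasProd (fun k : ℕ => 1 - x * q ^ k) (qRisingInf x q) := by
  have h : Multipliable (fun k : ℕ => 1 + -(x * q ^ k)) := by
    apply multipliable_one_add_of_summable
    simpa [norm_neg, norm_mul, norm_pow] using
      (summable_geometric_of_lt_one (norm_nonneg q) hq).mul_left ‖x‖
  simpa [qRisingInf, sub_eq_add_neg] using h.hasProd

/-- The quotient `z / w` of two complex numbers as a point of the extended complex plane
`ℂ ∪ {∞}`; it is `∞` when `w = 0`. -/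
noncomputable def extDiv (z w : ℂ) : OnePoint ℂ := if w = 0 then ∞ else ((z / w : ℂ) : OnePoint ℂ)

/-- The mapping `w ↦ α / (β + w)` of the extended complex plane to itself; it sends `∞` to `0`
and `-β` to `∞`. -/
noncomputable def cfStep (α β : ℂ) (w : OnePoint ℂ) : OnePoint ℂ :=
  w.elim ((0 : ℂ) : OnePoint ℂ) (fun z => extDiv α (β + z))

/-- The modified approximants of the continued fraction
`β 0 + α 1 / (β 1 + α 2 / (β 2 + ⋯))`: one has `S_0(w) = β 0 + w` and
`S_n(w) = S_{n-1}(α n / (β n + w))`, so that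
`S_n(w) = β 0 + α 1 / (β 1 + ⋯ + α n / (β n + w))`.  The entry `α 0` is not used. -/
noncomputable def cfApprox (α β : ℕ → ℂ) : ℕ → OnePoint ℂ → OnePoint ℂ
  | 0, w => OnePoint.map (fun z => β 0 + z) w
  | n + 1, w => cfApprox α β n (cfStep (α (n + 1)) (β (n + 1)) w)

/-- The continued fraction with partial numerators `α n` and partial denominators `β n`
converges to the extended complex number `S`: its approximants `S_n(0)` tend to `S`. -/
def CFConvergesTo (α β : ℕ → ℂ) (S : OnePoint ℂ) : Prop :=
  Tendsto (fun n : ℕ => cfApprox α β n ((0 : ℂ) : OnePoint ℂ)) atTop (𝓝 S)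

/-- Partial numerators of Ramanujan's continued fraction:
`1, (a - bq)(b - aq), (a - bq³)(b - aq³), …`, indexed from `1`. -/
def entryNum (a b q : ℂ) : ℕ → ℂ
  | 0 => 0
  | 1 => 1
  | n + 2 => (a - b * q ^ (2 * n + 1)) * (b - a * q ^ (2 * n + 1))

/-- Partial denominators of Ramanujan's continued fraction: the leading term is `0`, followed by
`1 - ab, (1 - ab)(1 + q²), (1 - ab)(1 + q⁴), …`. -/
def entryDen (a b q : ℂ) : ℕ → ℂ
  | 0 => 0
  | 1 => 1 - a * b
  | n + 2 => (1 - a * b) * (1 + q ^ (2 * n + 2))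

/-!
Write `F(a, b)` for the value of the continued fraction.  The Bauer–Muir transformation of its
reciprocal with modifying factors `w_m = ab - q^(2m)` is again a continued fraction of the same
kind, with `a, b` replaced by `aq, bq`; this gives
`F(a, b) * F(aq, bq) = 1 / ((1 - a²q) (1 - b²q))`, and iterating it produces the products.

To avoid any division, the argument is carried out on the canonical numerators `N` and
denominators `D`.  The transformation is then a pair of polynomial identities,
`entryD_bauerMuir` and `entryN_bauerMuir`, which hold without exceptions on the parameters.
The recurrence for `N` and `D` is a geometrically small perturbation of one with characteristic
roots `1` and `-ab`, so that, as `|ab| < 1`, both sequences converge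
(`exists_tendsto_of_defect_le`), and the identities pass to the limits `N∞` and `D∞`.  Two
transformations relate `D∞(a, b)` to `D∞(aq², bq²)` (`entryLim_shift`).  Since `D∞` is continuous
along `(aq^(2n), bq^(2n)) → (0, 0)` by dominated convergence (`tendsto_entryLim`), and `D∞(0, 0)`
is the nonzero product `(-q²; q²)_∞`, iteration gives
`(-ab, -abq²; q⁴)_∞ D∞(a, b) = (a²q, b²q; q⁴)_∞ D∞(0, 0)`, which is `entryLim_eq`, and the
same with `a²q³, b²q³` for `N∞(a, b) = D∞(aq, bq) / (1 + ab)`.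

The two products have no common zero (`products_ne_zero_or`), so `(N∞, D∞) ≠ (0, 0)`.  Hence
`(N n, D n) ≠ (0, 0)` from some index on, and there the approximant is `N n / D n` in `ℂ ∪ {∞}`,
even if some partial numerators vanish (`cfApprox_extDiv`); continuity of the quotient away
from `(0, 0)` finishes the proof.
-/

/-! ### Infinite products -/

theorem tendsto_prod_qRisingInf (x : ℂ) {p : ℂ} (hp : ‖p‖ < 1) :
    Tendsto (fun n : ℕ => ∏ k ∈ Finset.range n, (1 - x * p ^ k)) atTop (𝓝 (qRisingInf x p)) :=
  (hasProd_qRisingInf x hp).tendsto_prod_nat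

theorem qRisingInf_ne_zero {x p : ℂ} (hp : ‖p‖ < 1) (h : ∀ k : ℕ, x * p ^ k ≠ 1) :
    qRisingInf x p ≠ 0 := by
  have key : ∏' k : ℕ, (1 + -(x * p ^ k)) ≠ 0 := by
    apply tprod_one_add_ne_zero_of_summable
    · intro k hk
      exact h k (by linear_combination -hk)
    · simpa [norm_neg, norm_mul, norm_pow] using
        (summable_geometric_of_lt_one (norm_nonneg p) hp).mul_left ‖x‖
  simpa [qRisingInf, sub_eq_add_neg] using key

theorem qRisingInf_ne_zero_of_norm_lt_one {x p : ℂ} (hp : ‖p‖ < 1) (hx : ‖x‖ < 1) :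
    qRisingInf x p ≠ 0 := by
  refine qRisingInf_ne_zero hp fun k hk => ?_
  have h1 : ‖x‖ * ‖p‖ ^ k = 1 := by rw [← norm_pow, ← norm_mul, hk, norm_one]
  have h2 : ‖p‖ ^ k ≤ 1 := pow_le_one₀ (norm_nonneg p) hp.le
  nlinarith [norm_nonneg x]

theorem qRisingInf_eq_mul (x : ℂ) {p : ℂ} (hp : ‖p‖ < 1) :
    qRisingInf x p = (1 - x) * qRisingInf (x * p) p := by
  have h1 := (tendsto_prod_qRisingInf x hp).comp (tendsto_add_atTop_nat 1)
  have h2 := (tendsto_prod_qRisingInf (x * p) hp).const_mul (1 - x)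
  refine tendsto_nhds_unique h1 (h2.congr fun n => ?_)
  simp only [Function.comp_apply, Finset.prod_range_succ', pow_zero, mul_one]
  rw [mul_comm]
  congr 1
  exact Finset.prod_congr rfl fun k _ => by ring

/-- The two products have no common zero.  A common zero gives an equation `x * (q ^ 4) ^ k = 1`
from each of them; dividing these equations if they involve the same parameter, and multiplying
them otherwise, shows that a positive power of `q`, or `(a * b) ^ 2` times a power of `q`,
equals one. -/
theorem products_ne_zero_or (a b : ℂ) {q : ℂ} (hq : ‖q‖ < 1) (hab : ‖a * b‖ < 1) :
    qRisingInf (a ^ 2 * q ^ 3) (q ^ 4) * qRisingInf (b ^ 2 * q ^ 3) (q ^ 4) ≠ 0 ∨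
      qRisingInf (a ^ 2 * q) (q ^ 4) * qRisingInf (b ^ 2 * q) (q ^ 4) ≠ 0 := by
  have hq4 : ‖q ^ 4‖ < 1 := by
    rw [norm_pow]; exact pow_lt_one₀ (norm_nonneg q) hq (by norm_num)
  have zero_imp : ∀ {x : ℂ}, qRisingInf x (q ^ 4) = 0 → ∃ k : ℕ, x * (q ^ 4) ^ k = 1 := by
    intro x hx
    by_contra! h
    exact qRisingInf_ne_zero hq4 h hx
  have pow_ne : ∀ m : ℕ, m ≠ 0 → q ^ m ≠ 1 := by
    intro m hm h
    have h1 : ‖q‖ ^ m < 1 := pow_lt_one₀ (norm_nonneg q) hq hm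
    rw [← norm_pow, h, norm_one] at h1
    exact lt_irrefl _ h1
  have same : ∀ (x : ℂ) (k j : ℕ), x ^ 2 * q ^ 3 * (q ^ 4) ^ k = 1 →
      x ^ 2 * q * (q ^ 4) ^ j = 1 → False := by
    intro x k j hk hj
    rcases le_total j k with h | h
    · obtain ⟨i, rfl⟩ := Nat.exists_eq_add_of_le h
      refine pow_ne (4 * i + 2) (by omega) ?_
      calc q ^ (4 * i + 2) = x ^ 2 * q * (q ^ 4) ^ j * q ^ (4 * i + 2) := by rw [hj, one_mul]
        _ = x ^ 2 * q ^ 3 * (q ^ 4) ^ (j + i) := by ring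
        _ = 1 := hk
    · rcases h.eq_or_lt with rfl | h
      · refine pow_ne 2 (by omega) ?_
        calc q ^ 2 = x ^ 2 * q * (q ^ 4) ^ k * q ^ 2 := by rw [hj, one_mul]
          _ = x ^ 2 * q ^ 3 * (q ^ 4) ^ k := by ring
          _ = 1 := hk
      · obtain ⟨i, rfl⟩ := Nat.exists_eq_add_of_lt h
        refine pow_ne (4 * i + 2) (by omega) ?_
        calc q ^ (4 * i + 2) = x ^ 2 * q ^ 3 * (q ^ 4) ^ k * q ^ (4 * i + 2) := by
              rw [hk, one_mul]
          _ = x ^ 2 * q * (q ^ 4) ^ (k + i + 1) := by ring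
          _ = 1 := hj
  have cross : ∀ (x y : ℂ) (k j : ℕ), ‖x * y‖ < 1 → x ^ 2 * q ^ 3 * (q ^ 4) ^ k = 1 →
      y ^ 2 * q * (q ^ 4) ^ j = 1 → False := by
    intro x y k j hxy hk hj
    have h1 : (x * y) ^ 2 * q ^ (4 + 4 * k + 4 * j) = 1 := by
      calc (x * y) ^ 2 * q ^ (4 + 4 * k + 4 * j)
          = (x ^ 2 * q ^ 3 * (q ^ 4) ^ k) * (y ^ 2 * q * (q ^ 4) ^ j) := by ring
        _ = 1 := by rw [hk, hj, one_mul]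
    have h2 : ‖x * y‖ ^ 2 * ‖q‖ ^ (4 + 4 * k + 4 * j) = 1 := by
      rw [← norm_pow, ← norm_pow, ← norm_mul, h1, norm_one]
    have h3 : ‖q‖ ^ (4 + 4 * k + 4 * j) ≤ 1 := pow_le_one₀ (norm_nonneg q) hq.le
    have h4 : ‖x * y‖ ^ 2 < 1 := pow_lt_one₀ (norm_nonneg _) hxy (by norm_num)
    nlinarith [sq_nonneg ‖x * y‖]
  by_contra! h
  obtain ⟨h3, h1⟩ := h
  have hba : ‖b * a‖ < 1 := by rwa [mul_comm]
  rcases mul_eq_zero.1 h3 with h3 | h3 <;> rcases mul_eq_zero.1 h1 with h1 | h1 <;>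
    obtain ⟨k, hk⟩ := zero_imp h3 <;> obtain ⟨j, hj⟩ := zero_imp h1
  · exact same a k j hk hj
  · exact cross a b k j hab hk hj
  · exact cross b a k j hba hk hj
  · exact same b k j hk hj

/-! ### The extended complex plane and the approximants -/

theorem extDiv_mul_left {c : ℂ} (hc : c ≠ 0) (z w : ℂ) :
    extDiv (c * z) (c * w) = extDiv z w := by
  by_cases hw : w = 0
  · simp [extDiv, hw]
  · simp [extDiv, hw, hc, mul_div_mul_left]

/-- Away from the indeterminate pair `(0, 0)`, the quotient in `ℂ ∪ {∞}` is continuous. -/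
theorem tendsto_extDiv {ι : Type*} {l : Filter ι} {u v : ι → ℂ} {z w : ℂ}
    (hu : Tendsto u l (𝓝 z)) (hv : Tendsto v l (𝓝 w)) (h : z ≠ 0 ∨ w ≠ 0) :
    Tendsto (fun i => extDiv (u i) (v i)) l (𝓝 (extDiv z w)) := by
  by_cases hw : w = 0
  · subst hw
    have hz : z ≠ 0 := by simpa using h
    rw [extDiv, if_pos rfl, OnePoint.hasBasis_nhds_infty.tendsto_right_iff]
    rintro s ⟨-, hs⟩
    obtain ⟨R, hR⟩ := hs.isBounded.exists_norm_le
    have hlim : Tendsto (fun i => R * ‖v i‖ - ‖u i‖) l (𝓝 (R * ‖(0 : ℂ)‖ - ‖z‖)) :=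
      (hv.norm.const_mul R).sub hu.norm
    have hneg : R * ‖(0 : ℂ)‖ - ‖z‖ < 0 := by simpa using hz
    filter_upwards [hlim.eventually_lt_const hneg] with i hi
    by_cases hvi : v i = 0
    · right
      simp [extDiv, hvi]
    · left
      refine ⟨u i / v i, fun hmem => ?_, by simp [extDiv, hvi]⟩
      have h1 := hR _ hmem
      rw [norm_div, div_le_iff₀ (norm_pos_iff.2 hvi)] at h1
      linarith
  · have h1 : Tendsto (fun i => ((u i / v i : ℂ) : OnePoint ℂ)) l (𝓝 ((z / w : ℂ) : OnePoint ℂ)) :=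
      (OnePoint.continuous_coe.tendsto _).comp (hu.div hv hw)
    rw [extDiv, if_neg hw]
    refine h1.congr' ?_
    filter_upwards [hv.eventually_ne hw] with i hi
    simp [extDiv, hi]

/-- On homogeneous coordinates the step `w ↦ α / (β + w)` is linear.  This also holds when
`α = 0` and `β * y + x = 0`, because of the convention that `-β` is sent to `∞`. -/
theorem cfStep_extDiv (α β : ℂ) {x y : ℂ} (h : x ≠ 0 ∨ y ≠ 0) :
    cfStep α β (extDiv x y) = extDiv (α * y) (β * y + x) := by
  by_cases hy : y = 0
  · have hx : x ≠ 0 := by simpa [hy] using h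
    simp [extDiv, cfStep, hy, hx]
  · have e : β + x / y = (β * y + x) / y := by field_simp
    by_cases h0 : β * y + x = 0
    · simp [extDiv, cfStep, hy, e, h0]
    · have e2 : α / ((β * y + x) / y) = α * y / (β * y + x) := by field_simp
      simp [extDiv, cfStep, hy, e, h0, e2]

/-- The solution `h` of the recurrence `h (n + 1) = β n * h n + α n * h (n - 1)` attached to a
continued fraction, indexed with a shift by one: the entries at `0` and `1` are the prescribed
values of `h (-1)` and `h 0`.  The canonical numerators and denominators are the solutions with
initial values `1, β 0` and `0, 1`. -/
def cfSeq (α β : ℕ → ℂ) (x y : ℂ) : ℕ → ℂ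
  | 0 => x
  | 1 => y
  | n + 2 => β (n + 1) * cfSeq α β x y (n + 1) + α (n + 1) * cfSeq α β x y n

/-- The approximants in terms of canonical numerators and denominators.  If the pair on the right
is not `(0, 0)`, then by linearity no intermediate pair is, so vanishing partial numerators need
no separate treatment. -/
theorem cfApprox_extDiv (α β : ℕ → ℂ) (n : ℕ) : ∀ x y : ℂ,
    (cfSeq α β 1 (β 0) (n + 1) * y + cfSeq α β 1 (β 0) n * x ≠ 0 ∨
      cfSeq α β 0 1 (n + 1) * y + cfSeq α β 0 1 n * x ≠ 0) →
    cfApprox α β n (extDiv x y) =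
      extDiv (cfSeq α β 1 (β 0) (n + 1) * y + cfSeq α β 1 (β 0) n * x)
        (cfSeq α β 0 1 (n + 1) * y + cfSeq α β 0 1 n * x) := by
  induction n with
  | zero =>
    intro x y _
    by_cases hy : y = 0
    · simp [cfApprox, cfSeq, extDiv, hy]
    · have e : β 0 + x / y = (β 0 * y + x) / y := by field_simp
      simp [cfApprox, cfSeq, extDiv, hy, e]
  | succ n ih =>
    intro x y h
    have e : ∀ s t : ℂ, cfSeq α β s t (n + 1 + 1) * y + cfSeq α β s t (n + 1) * x =
        cfSeq α β s t (n + 1) * (β (n + 1) * y + x) + cfSeq α β s t n * (α (n + 1) * y) := by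
      intro s t
      rw [cfSeq]
      ring
    rw [e, e] at h ⊢
    have hxy : x ≠ 0 ∨ y ≠ 0 := by
      by_contra! h0
      simp [h0.1, h0.2] at h
    rw [cfApprox, cfStep_extDiv _ _ hxy, ih _ _ h]

theorem cfConvergesTo_of_tendsto {α β : ℕ → ℂ} {z w : ℂ}
    (hz : Tendsto (fun n => cfSeq α β 1 (β 0) (n + 1)) atTop (𝓝 z))
    (hw : Tendsto (fun n => cfSeq α β 0 1 (n + 1)) atTop (𝓝 w)) (h : z ≠ 0 ∨ w ≠ 0) :
    CFConvergesTo α β (extDiv z w) := by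
  refine (tendsto_extDiv hz hw h).congr' ?_
  have hne : ∀ᶠ n in atTop, cfSeq α β 1 (β 0) (n + 1) ≠ 0 ∨ cfSeq α β 0 1 (n + 1) ≠ 0 := by
    rcases h with h | h
    · exact (hz.eventually_ne h).mono fun _ => Or.inl
    · exact (hw.eventually_ne h).mono fun _ => Or.inr
  filter_upwards [hne] with n hn
  have := cfApprox_extDiv α β n 0 1 (by simpa using hn)
  simpa [extDiv] using this.symm

/-! ### Recurrences close to one with characteristic roots `1` and `-p` -/

/-- A uniform bound for sequences whose defect `X (m + 2) - (1 - p) X (m + 1) - p X m` is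
geometrically small relative to `X`. -/
theorem norm_le_of_defect_le {X : ℕ → ℂ} {p : ℂ} {r t c₁ c₂ B : ℝ} (hp : ‖p‖ ≤ r) (hr : r < 1)
    (ht0 : 0 ≤ t) (ht : t < 1) (hc₁ : 0 ≤ c₁) (hc₂ : 0 ≤ c₂) (h0 : ‖X 0‖ ≤ B) (h1 : ‖X 1‖ ≤ B)
    (hX : ∀ m, ‖X (m + 2) - (1 - p) * X (m + 1) - p * X m‖ ≤
      t ^ m * (c₁ * ‖X (m + 1)‖ + c₂ * ‖X m‖)) (m : ℕ) :
    ‖X m‖ ≤ 2 * B / (1 - r) * Real.exp ((c₁ + c₂) / (1 - r) * (1 - t)⁻¹) := by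
  have hr0 : 0 ≤ r := (norm_nonneg p).trans hp
  have hr1 : 0 < 1 - r := by linarith
  have hB : 0 ≤ B := (norm_nonneg _).trans h0
  set δ : ℕ → ℝ := fun k => (c₁ + c₂) / (1 - r) * t ^ k with hδ
  have hδ0 : ∀ k, 0 ≤ δ k := fun k => by positivity
  set V : ℕ → ℝ := fun n => 2 * B / (1 - r) * Real.exp (∑ k ∈ Finset.range n, δ k) with hV
  have hV0 : ∀ n, 0 ≤ V n := fun n => by positivity
  have hVs : ∀ n, V n * (1 + δ n) ≤ V (n + 1) := by
    intro n
    have : V (n + 1) = V n * Real.exp (δ n) := by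
      simp only [hV, Finset.sum_range_succ, Real.exp_add]; ring
    rw [this]
    exact mul_le_mul_of_nonneg_left (by linarith [Real.add_one_le_exp (δ n)]) (hV0 n)
  -- The combination `X (n + 1) + p X n` would be constant if the defect vanished.
  have key : ∀ n, ‖X n‖ ≤ V n ∧ ‖X (n + 1)‖ ≤ V n ∧ ‖X (n + 1) + p * X n‖ ≤ (1 - r) * V n := by
    intro n
    induction n with
    | zero =>
      have e : (1 - r) * V 0 = 2 * B := by simp [hV]; field_simp
      have hBV : B ≤ V 0 := by nlinarith [hV0 0]
      refine ⟨h0.trans hBV, h1.trans hBV, ?_⟩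
      rw [e]
      calc ‖X (0 + 1) + p * X 0‖ ≤ ‖X 1‖ + ‖p‖ * ‖X 0‖ := by
            rw [← norm_mul]; exact norm_add_le _ _
        _ ≤ 2 * B := by nlinarith [norm_nonneg (X 0), norm_nonneg p]
    | succ n ih =>
      obtain ⟨i1, i2, i3⟩ := ih
      have hs := hVs n
      have hmono : V n ≤ V (n + 1) := by nlinarith [mul_nonneg (hV0 n) (hδ0 n)]
      have hY : ‖X (n + 1 + 1) + p * X (n + 1)‖ ≤ (1 - r) * V (n + 1) := by
        calc ‖X (n + 1 + 1) + p * X (n + 1)‖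
            = ‖(X (n + 1) + p * X n) + (X (n + 2) - (1 - p) * X (n + 1) - p * X n)‖ := by
              congr 1; ring
          _ ≤ (1 - r) * V n + t ^ n * (c₁ * V n + c₂ * V n) := by
              refine (norm_add_le _ _).trans (add_le_add i3 ((hX n).trans ?_))
              gcongr
          _ = (1 - r) * (V n * (1 + δ n)) := by simp only [hδ]; field_simp
          _ ≤ (1 - r) * V (n + 1) := by gcongr
      refine ⟨i2.trans hmono, ?_, hY⟩
      calc ‖X (n + 1 + 1)‖ = ‖(X (n + 1 + 1) + p * X (n + 1)) - p * X (n + 1)‖ := by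
            congr 1; ring
        _ ≤ (1 - r) * V (n + 1) + r * V (n + 1) := by
            refine (norm_sub_le _ _).trans (add_le_add hY ?_)
            rw [norm_mul]
            exact mul_le_mul hp (i2.trans hmono) (norm_nonneg _) hr0
        _ = V (n + 1) := by ring
  refine (key m).1.trans ?_
  have hsum : ∑ k ∈ Finset.range m, δ k ≤ (c₁ + c₂) / (1 - r) * (1 - t)⁻¹ := by
    have hs := (hasSum_geometric_of_lt_one ht0 ht).mul_left ((c₁ + c₂) / (1 - r))
    exact sum_le_hasSum _ (fun k _ => hδ0 k) hs
  simp only [hV]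
  gcongr

/-- A sequence with geometrically small defect converges, and its limit is determined by the sum
of the defects, because `X (m + 1) + p X m` telescopes. -/
theorem exists_tendsto_of_defect_le {X : ℕ → ℂ} {p : ℂ} {t C : ℝ} (hp : ‖p‖ < 1)
    (ht0 : 0 ≤ t) (ht : t < 1)
    (hX : ∀ m, ‖X (m + 2) - (1 - p) * X (m + 1) - p * X m‖ ≤ C * t ^ m) :
    ∃ ℓ, Tendsto X atTop (𝓝 ℓ) ∧ (1 + p) * ℓ =
      X 1 + p * X 0 + ∑' m, (X (m + 2) - (1 - p) * X (m + 1) - p * X m) := by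
  set Δ : ℕ → ℂ := fun m => X (m + 2) - (1 - p) * X (m + 1) - p * X m with hΔ
  have hgeo := (hasSum_geometric_of_lt_one ht0 ht).mul_left C
  have hC : ∀ m, 0 ≤ C * t ^ m := fun m => (norm_nonneg _).trans (hX m)
  have hΔs : Summable Δ := Summable.of_norm_bounded hgeo.summable hX
  set d : ℕ → ℝ := fun m => ‖X (m + 1) - X m‖ with hd
  have hd1 : ∀ m, d (m + 1) ≤ ‖p‖ * d m + C * t ^ m := by
    intro m
    calc d (m + 1) = ‖-(p * (X (m + 1) - X m)) + Δ m‖ := by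
          simp only [hd, hΔ]; congr 1; ring
      _ ≤ ‖p‖ * d m + C * t ^ m := by
          refine (norm_add_le _ _).trans (add_le_add ?_ (hX m))
          rw [norm_neg, norm_mul]
  have hsum : Summable d := by
    refine summable_of_sum_range_le (c := (d 0 + C * (1 - t)⁻¹) / (1 - ‖p‖))
      (fun m => norm_nonneg _) fun n => ?_
    rw [le_div_iff₀ (by linarith)]
    have h1 : ∑ k ∈ Finset.range (n + 1), d k ≤
        ‖p‖ * ∑ k ∈ Finset.range n, d k + C * (1 - t)⁻¹ + d 0 := by
      rw [Finset.sum_range_succ', Finset.mul_sum]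
      gcongr
      calc ∑ k ∈ Finset.range n, d (k + 1)
          ≤ ∑ k ∈ Finset.range n, (‖p‖ * d k + C * t ^ k) := Finset.sum_le_sum fun k _ => hd1 k
        _ ≤ _ := by
          rw [Finset.sum_add_distrib]
          gcongr
          exact sum_le_hasSum _ (fun k _ => hC k) hgeo
    rw [Finset.sum_range_succ] at h1
    have : 0 ≤ d n := norm_nonneg _
    linarith
  have hcauchy : CauchySeq X := by
    refine cauchySeq_of_summable_dist (hsum.congr fun m => ?_)
    rw [dist_comm, dist_eq_norm]
  obtain ⟨ℓ, hℓ⟩ := cauchySeq_tendsto_of_complete hcauchy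
  refine ⟨ℓ, hℓ, ?_⟩
  have hY : Tendsto (fun n => X (n + 1) + p * X n) atTop (𝓝 (ℓ + p * ℓ)) :=
    (hℓ.comp (tendsto_add_atTop_nat 1)).add (hℓ.const_mul p)
  have hY2 := (hΔs.hasSum.tendsto_sum_nat).const_add (X 1 + p * X 0)
  have htel : ∀ n, X 1 + p * X 0 + ∑ m ∈ Finset.range n, Δ m = X (n + 1) + p * X n := by
    intro n
    induction n with
    | zero => simp
    | succ n ih => rw [Finset.sum_range_succ, ← add_assoc, ih]; simp only [hΔ]; ring
  rw [← tendsto_nhds_unique hY (hY2.congr htel)]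
  ring

/-! ### Ramanujan's recurrence and its Bauer–Muir transformation -/

/-- Solutions of the three-term recurrence of Ramanujan's continued fraction, from the index `2`
on. -/
def IsEntrySol (a b q : ℂ) (X : ℕ → ℂ) : Prop :=
  ∀ m, X (m + 2) = entryDen a b q (m + 2) * X (m + 1) + entryNum a b q (m + 2) * X m

/-- The `n`-th canonical numerator of Ramanujan's continued fraction. -/
def entryN (a b q : ℂ) (n : ℕ) : ℂ := cfSeq (entryNum a b q) (entryDen a b q) 1 0 (n + 1)

/-- The `n`-th canonical denominator of Ramanujan's continued fraction. -/
def entryD (a b q : ℂ) (n : ℕ) : ℂ := cfSeq (entryNum a b q) (entryDen a b q) 0 1 (n + 1)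

section Recurrence

variable {a b q : ℂ}

theorem isEntrySol_entryN : IsEntrySol a b q (entryN a b q) := fun m => by
  simp only [entryN]; rw [cfSeq]

theorem isEntrySol_entryD : IsEntrySol a b q (entryD a b q) := fun m => by
  simp only [entryD]; rw [cfSeq]

theorem entryN_zero : entryN a b q 0 = 0 := rfl

theorem entryN_one : entryN a b q 1 = 1 := by simp [entryN, cfSeq, entryNum]

theorem entryD_zero : entryD a b q 0 = 1 := rfl

theorem entryD_one : entryD a b q 1 = 1 - a * b := by simp [entryD, cfSeq, entryDen]

theorem IsEntrySol.const_mul {X : ℕ → ℂ} (hX : IsEntrySol a b q X) (c : ℂ) :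
    IsEntrySol a b q fun m => c * X m := fun m => by
  simp only [hX m]; ring

theorem IsEntrySol.ext {X Y : ℕ → ℂ} (hX : IsEntrySol a b q X) (hY : IsEntrySol a b q Y)
    (h0 : X 0 = Y 0) (h1 : X 1 = Y 1) (m : ℕ) : X m = Y m := by
  induction m using Nat.twoStepInduction with
  | zero => exact h0
  | one => exact h1
  | more m ih0 ih1 => rw [hX m, hY m, ih0, ih1]

/-- The Bauer–Muir transformation with modifying factors `a b - q ^ (2 m)` replaces the parameters
`a, b` by `a q, b q`. -/
theorem IsEntrySol.bauerMuir {X : ℕ → ℂ} (hX : IsEntrySol a b q X) :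
    IsEntrySol (a * q) (b * q) q fun m => X (m + 1) + (a * b - q ^ (2 * m)) * X m := by
  intro m
  have h2 := hX m
  have h3 := hX (m + 1)
  simp only [entryDen, entryNum] at h2 h3 ⊢
  rw [show m + 1 + 2 = m + 2 + 1 by ring, show m + 1 + 1 = m + 2 by ring] at h3
  rw [show m + 1 + 1 = m + 2 by ring, h3, h2]
  ring

theorem entryD_bauerMuir (m : ℕ) :
    entryD a b q (m + 1) + (a * b - q ^ (2 * m)) * entryD a b q m =
      (1 - a ^ 2 * q) * (1 - b ^ 2 * q) * entryN (a * q) (b * q) q m := by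
  refine isEntrySol_entryD.bauerMuir.ext (isEntrySol_entryN.const_mul _) ?_ ?_ m
  · simp [entryD_zero, entryD_one, entryN_zero]
  · have h := isEntrySol_entryD (a := a) (b := b) (q := q) 0
    simp only [zero_add, entryD_one, entryD_zero, entryDen, entryNum] at h
    simp only [h, entryD_one, entryN_one, one_add_one_eq_two]
    ring

theorem entryN_bauerMuir (m : ℕ) :
    entryN a b q (m + 1) + (a * b - q ^ (2 * m)) * entryN a b q m =
      entryD (a * q) (b * q) q m := by
  refine isEntrySol_entryN.bauerMuir.ext isEntrySol_entryD ?_ ?_ m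
  · simp [entryN_zero, entryN_one, entryD_zero]
  · have h := isEntrySol_entryN (a := a) (b := b) (q := q) 0
    simp only [zero_add, entryN_one, entryN_zero, entryDen] at h
    simp only [h, entryN_one, entryD_one, one_add_one_eq_two]
    ring

theorem IsEntrySol.defect_eq {X : ℕ → ℂ} (hX : IsEntrySol a b q X) (m : ℕ) :
    X (m + 2) - (1 - a * b) * X (m + 1) - a * b * X m =
      q ^ m * ((1 - a * b) * q ^ (m + 2) * X (m + 1) +
        (a * b * q ^ (3 * m + 2) - (a ^ 2 + b ^ 2) * q ^ (m + 1)) * X m) := by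
  rw [hX m]
  simp only [entryDen, entryNum]
  ring

theorem IsEntrySol.norm_defect_le {X : ℕ → ℂ} (hX : IsEntrySol a b q X) (hq : ‖q‖ < 1)
    (hab : ‖a * b‖ < 1) {s : ℝ} (hs : ‖a‖ ^ 2 + ‖b‖ ^ 2 ≤ s) (m : ℕ) :
    ‖X (m + 2) - (1 - a * b) * X (m + 1) - a * b * X m‖ ≤
      ‖q‖ ^ m * (2 * ‖X (m + 1)‖ + (1 + s) * ‖X m‖) := by
  have hpow : ∀ k, ‖q ^ k‖ ≤ 1 := fun k => by
    rw [norm_pow]; exact pow_le_one₀ (norm_nonneg q) hq.le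
  have h1 : ‖1 - a * b‖ ≤ 2 := by
    refine (norm_sub_le _ _).trans ?_
    rw [norm_one]; linarith
  have hs0 : 0 ≤ s := le_trans (by positivity) hs
  have h2 : ‖a ^ 2 + b ^ 2‖ ≤ s := by
    refine (norm_add_le _ _).trans ?_
    rwa [norm_pow, norm_pow]
  rw [hX.defect_eq, norm_mul, norm_pow]
  gcongr
  refine (norm_add_le _ _).trans ?_
  rw [norm_mul, norm_mul _ (X m)]
  gcongr
  · rw [norm_mul]
    exact (mul_le_mul h1 (hpow _) (norm_nonneg _) zero_le_two).trans_eq (mul_one 2)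
  · refine (norm_sub_le _ _).trans ?_
    rw [norm_mul, norm_mul (a ^ 2 + b ^ 2)]
    exact add_le_add (mul_le_one₀ hab.le (norm_nonneg _) (hpow _))
      ((mul_le_mul h2 (hpow _) (norm_nonneg _) hs0).trans_eq (mul_one s))

/-- The defects of solutions with initial values of modulus at most `2` satisfy a geometric bound
that is uniform in the parameters. -/
theorem exists_defect_bound (hq : ‖q‖ < 1) {r s : ℝ} (hr : r < 1) (hs : 0 ≤ s) :
    ∃ C, ∀ a b : ℂ, ‖a * b‖ ≤ r → ‖a‖ ^ 2 + ‖b‖ ^ 2 ≤ s → ∀ X, IsEntrySol a b q X →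
      ‖X 0‖ ≤ 2 → ‖X 1‖ ≤ 2 → ∀ m,
        ‖X (m + 2) - (1 - a * b) * X (m + 1) - a * b * X m‖ ≤ C * ‖q‖ ^ m := by
  refine ⟨(2 + (1 + s)) * (2 * 2 / (1 - r) *
    Real.exp ((2 + (1 + s)) / (1 - r) * (1 - ‖q‖)⁻¹)), ?_⟩
  intro a b hab hab2 X hX h0 h1 m
  have hd := hX.norm_defect_le hq (hab.trans_lt hr) hab2
  have hbd := norm_le_of_defect_le hab hr (norm_nonneg q) hq (by norm_num) (by linarith)
    h0 h1 hd
  refine (hd m).trans ?_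
  rw [mul_comm, add_mul 2 (1 + s)]
  gcongr
  · exact hbd _
  · exact hbd _

theorem norm_entryD_one_le (hab : ‖a * b‖ < 1) : ‖entryD a b q 1‖ ≤ 2 := by
  rw [entryD_one]
  refine (norm_sub_le _ _).trans ?_
  rw [norm_one]; linarith

theorem exists_tendsto_entryN (hq : ‖q‖ < 1) (hab : ‖a * b‖ < 1) :
    ∃ ℓ, Tendsto (entryN a b q) atTop (𝓝 ℓ) := by
  obtain ⟨C, hC⟩ := exists_defect_bound hq hab (s := ‖a‖ ^ 2 + ‖b‖ ^ 2) (by positivity)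
  obtain ⟨ℓ, hℓ, -⟩ := exists_tendsto_of_defect_le hab (norm_nonneg q) hq
    (hC a b le_rfl le_rfl _ isEntrySol_entryN (by simp [entryN_zero]) (by simp [entryN_one]))
  exact ⟨ℓ, hℓ⟩

/-- The limit of the canonical denominators. -/
noncomputable def entryLim (a b q : ℂ) : ℂ := limUnder atTop (entryD a b q)

theorem tendsto_entryD_and_entryLim_eq (hq : ‖q‖ < 1) (hab : ‖a * b‖ < 1) :
    Tendsto (entryD a b q) atTop (𝓝 (entryLim a b q)) ∧
      (1 + a * b) * entryLim a b q = 1 + ∑' m, (entryD a b q (m + 2) -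
        (1 - a * b) * entryD a b q (m + 1) - a * b * entryD a b q m) := by
  obtain ⟨C, hC⟩ := exists_defect_bound hq hab (s := ‖a‖ ^ 2 + ‖b‖ ^ 2) (by positivity)
  obtain ⟨ℓ, hℓ, h⟩ := exists_tendsto_of_defect_le hab (norm_nonneg q) hq
    (hC a b le_rfl le_rfl _ isEntrySol_entryD (by simp [entryD_zero]) (norm_entryD_one_le hab))
  have e : entryLim a b q = ℓ := hℓ.limUnder_eq
  rw [e]
  refine ⟨hℓ, h.trans ?_⟩
  rw [entryD_one, entryD_zero]
  ring

theorem tendsto_bauerMuir {X : ℕ → ℂ} {ℓ : ℂ} (hq : ‖q‖ < 1) (h : Tendsto X atTop (𝓝 ℓ)) :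
    Tendsto (fun m => X (m + 1) + (a * b - q ^ (2 * m)) * X m) atTop (𝓝 ((1 + a * b) * ℓ)) := by
  have hq2 : Tendsto (fun m : ℕ => q ^ (2 * m)) atTop (𝓝 0) :=
    (tendsto_pow_atTop_nhds_zero_of_norm_lt_one hq).comp
      (tendsto_id.const_mul_atTop' (by norm_num))
  have h1 := (h.comp (tendsto_add_atTop_nat 1)).add ((hq2.const_sub (a * b)).mul h)
  rw [show (1 + a * b) * ℓ = ℓ + (a * b - 0) * ℓ by ring]
  exact h1

theorem norm_mul_lt_one_of_shift (hq : ‖q‖ < 1) (hab : ‖a * b‖ < 1) :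
    ‖a * q * (b * q)‖ < 1 := by
  have e : a * q * (b * q) = a * b * q ^ 2 := by ring
  rw [e, norm_mul, norm_pow]
  exact mul_lt_one_of_nonneg_of_lt_one_left (norm_nonneg _) hab
    (pow_le_one₀ (norm_nonneg q) hq.le)

/-- The limit of the canonical numerators in terms of that of the denominators for `a q, b q`. -/
theorem entryN_limit (hq : ‖q‖ < 1) (hab : ‖a * b‖ < 1) {ℓ : ℂ}
    (hℓ : Tendsto (entryN a b q) atTop (𝓝 ℓ)) :
    (1 + a * b) * ℓ = entryLim (a * q) (b * q) q :=
  tendsto_nhds_unique ((tendsto_bauerMuir hq hℓ).congr entryN_bauerMuir)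
    (tendsto_entryD_and_entryLim_eq hq (norm_mul_lt_one_of_shift hq hab)).1

/-- Two Bauer–Muir transformations in a row. -/
theorem entryLim_shift (hq : ‖q‖ < 1) (hab : ‖a * b‖ < 1) :
    (1 + a * b) * (1 + a * b * q ^ 2) * entryLim a b q =
      (1 - a ^ 2 * q) * (1 - b ^ 2 * q) * entryLim (a * q ^ 2) (b * q ^ 2) q := by
  have hab' := norm_mul_lt_one_of_shift hq hab
  obtain ⟨ℓ, hℓ⟩ := exists_tendsto_entryN hq hab'
  have h1 : (1 + a * b) * entryLim a b q = (1 - a ^ 2 * q) * (1 - b ^ 2 * q) * ℓ :=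
    tendsto_nhds_unique
      ((tendsto_bauerMuir hq (tendsto_entryD_and_entryLim_eq hq hab).1).congr entryD_bauerMuir)
      (hℓ.const_mul _)
  have h2 := entryN_limit hq hab' hℓ
  rw [show a * q * q = a * q ^ 2 by ring, show b * q * q = b * q ^ 2 by ring] at h2
  rw [← h2]
  linear_combination (1 + a * b * q ^ 2) * h1

theorem norm_mul_shift_le (hq : ‖q‖ < 1) (n : ℕ) :
    ‖a * q ^ n * (b * q ^ n)‖ ≤ ‖a * b‖ := by
  have e : a * q ^ n * (b * q ^ n) = a * b * q ^ (2 * n) := by ring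
  rw [e, norm_mul, norm_pow]
  exact mul_le_of_le_one_right (norm_nonneg _) (pow_le_one₀ (norm_nonneg q) hq.le)

theorem entryLim_iterate (hq : ‖q‖ < 1) (hab : ‖a * b‖ < 1) (n : ℕ) :
    (∏ k ∈ Finset.range n, (1 - -(a * b) * (q ^ 4) ^ k)) *
        (∏ k ∈ Finset.range n, (1 - -(a * b * q ^ 2) * (q ^ 4) ^ k)) * entryLim a b q =
      (∏ k ∈ Finset.range n, (1 - a ^ 2 * q * (q ^ 4) ^ k)) *
        (∏ k ∈ Finset.range n, (1 - b ^ 2 * q * (q ^ 4) ^ k)) *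
          entryLim (a * q ^ (2 * n)) (b * q ^ (2 * n)) q := by
  induction n with
  | zero => simp
  | succ n ih =>
    have h := entryLim_shift hq ((norm_mul_shift_le hq (2 * n)).trans_lt hab)
    rw [show a * q ^ (2 * n) * q ^ 2 = a * q ^ (2 * (n + 1)) by ring,
      show b * q ^ (2 * n) * q ^ 2 = b * q ^ (2 * (n + 1)) by ring] at h
    simp only [Finset.prod_range_succ]
    linear_combination (1 - -(a * b) * (q ^ 4) ^ n) * (1 - -(a * b * q ^ 2) * (q ^ 4) ^ n) * ih +
      (∏ k ∈ Finset.range n, (1 - a ^ 2 * q * (q ^ 4) ^ k)) *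
        (∏ k ∈ Finset.range n, (1 - b ^ 2 * q * (q ^ 4) ^ k)) * h

/-! ### The limit of the canonical denominators -/

theorem tendsto_entryD_params {u v : ℕ → ℂ} {x y : ℂ} (hu : Tendsto u atTop (𝓝 x))
    (hv : Tendsto v atTop (𝓝 y)) (m : ℕ) :
    Tendsto (fun n => entryD (u n) (v n) q m) atTop (𝓝 (entryD x y q m)) := by
  induction m using Nat.twoStepInduction with
  | zero => simp only [entryD_zero]; exact tendsto_const_nhds
  | one => simp only [entryD_one]; exact (hu.mul hv).const_sub 1
  | more m ih0 ih1 =>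
    simp only [isEntrySol_entryD m, entryDen, entryNum]
    exact ((((hu.mul hv).const_sub 1).mul_const _).mul ih1).add
      (((hu.sub (hv.mul_const _)).mul (hv.sub (hu.mul_const _))).mul ih0)

/-- Continuity of the limit of the denominators along `(a q ^ (2 n), b q ^ (2 n)) → (0, 0)`, by
dominated convergence for the sum of the defects. -/
theorem tendsto_entryLim (hq : ‖q‖ < 1) (hab : ‖a * b‖ < 1) :
    Tendsto (fun n : ℕ => entryLim (a * q ^ (2 * n)) (b * q ^ (2 * n)) q) atTop
      (𝓝 (entryLim 0 0 q)) := by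
  have hq2 : Tendsto (fun n : ℕ => q ^ (2 * n)) atTop (𝓝 0) :=
    (tendsto_pow_atTop_nhds_zero_of_norm_lt_one hq).comp
      (tendsto_id.const_mul_atTop' (by norm_num))
  have hu : Tendsto (fun n : ℕ => a * q ^ (2 * n)) atTop (𝓝 0) := by
    simpa using hq2.const_mul a
  have hv : Tendsto (fun n : ℕ => b * q ^ (2 * n)) atTop (𝓝 0) := by
    simpa using hq2.const_mul b
  have hlt : ∀ n : ℕ, ‖a * q ^ (2 * n) * (b * q ^ (2 * n))‖ < 1 := fun n =>
    (norm_mul_shift_le hq (2 * n)).trans_lt hab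
  obtain ⟨C, hC⟩ := exists_defect_bound hq hab (s := ‖a‖ ^ 2 + ‖b‖ ^ 2) (by positivity)
  have hsq : ∀ (c : ℂ) (n : ℕ), ‖c * q ^ (2 * n)‖ ^ 2 ≤ ‖c‖ ^ 2 := by
    intro c n
    rw [norm_mul, norm_pow]
    gcongr
    exact mul_le_of_le_one_right (norm_nonneg _) (pow_le_one₀ (norm_nonneg q) hq.le)
  have hsum := tendsto_tsum_of_dominated_convergence
    (f := fun (n m : ℕ) => entryD (a * q ^ (2 * n)) (b * q ^ (2 * n)) q (m + 2) -
        (1 - a * q ^ (2 * n) * (b * q ^ (2 * n))) *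
          entryD (a * q ^ (2 * n)) (b * q ^ (2 * n)) q (m + 1) -
        a * q ^ (2 * n) * (b * q ^ (2 * n)) * entryD (a * q ^ (2 * n)) (b * q ^ (2 * n)) q m)
    (g := fun m => entryD 0 0 q (m + 2) - (1 - 0 * 0) * entryD 0 0 q (m + 1) -
      0 * 0 * entryD 0 0 q m) (𝓕 := atTop)
    ((summable_geometric_of_lt_one (norm_nonneg q) hq).mul_left C)
    (fun m => ((tendsto_entryD_params hu hv (m + 2)).sub
      (((hu.mul hv).const_sub 1).mul (tendsto_entryD_params hu hv (m + 1)))).sub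
        ((hu.mul hv).mul (tendsto_entryD_params hu hv m)))
    (Eventually.of_forall fun n m => hC _ _ (norm_mul_shift_le hq (2 * n))
      (add_le_add (hsq a n) (hsq b n)) _ isEntrySol_entryD (by simp [entryD_zero])
      (norm_entryD_one_le (hlt n)) m)
  have h0 := (tendsto_entryD_and_entryLim_eq (a := 0) (b := 0) hq (by simp)).2
  have hne : ∀ n : ℕ, 1 + a * q ^ (2 * n) * (b * q ^ (2 * n)) ≠ 0 := by
    intro n h
    have h1 := hlt n
    rw [show a * q ^ (2 * n) * (b * q ^ (2 * n)) = -1 by linear_combination h] at h1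
    simp at h1
  have hden : Tendsto (fun n : ℕ => 1 + a * q ^ (2 * n) * (b * q ^ (2 * n))) atTop
      (𝓝 (1 + 0 * 0)) := (hu.mul hv).const_add 1
  have hlim := (hsum.const_add 1).div hden (by simp)
  rw [← h0] at hlim
  simp only [mul_zero, add_zero, one_mul, div_one] at hlim
  refine hlim.congr fun n => ?_
  simp only [Pi.div_apply]
  rw [← (tendsto_entryD_and_entryLim_eq hq (hlt n)).2, mul_div_cancel_left₀ _ (hne n)]

theorem entryLim_zero_ne_zero (hq : ‖q‖ < 1) : entryLim 0 0 q ≠ 0 := by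
  have hq2 : ‖q ^ 2‖ < 1 := by
    rw [norm_pow]; exact pow_lt_one₀ (norm_nonneg q) hq (by norm_num)
  have hD : ∀ n : ℕ, ∏ k ∈ Finset.range n, (1 - -q ^ 2 * (q ^ 2) ^ k) =
      entryD 0 0 q (n + 1) := by
    intro n
    induction n with
    | zero => simp [entryD_one]
    | succ n ih =>
      rw [Finset.prod_range_succ, ih, isEntrySol_entryD n]
      simp only [entryDen, entryNum]
      ring
  have h1 := ((tendsto_entryD_and_entryLim_eq (a := 0) (b := 0) hq (by simp)).1).comp
    (tendsto_add_atTop_nat 1)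
  have h2 := (tendsto_prod_qRisingInf (-q ^ 2) hq2).congr hD
  rw [tendsto_nhds_unique h1 h2]
  exact qRisingInf_ne_zero_of_norm_lt_one hq2 (by rwa [norm_neg])

theorem entryLim_eq (hq : ‖q‖ < 1) (hab : ‖a * b‖ < 1) :
    qRisingInf (-(a * b)) (q ^ 4) * qRisingInf (-(a * b * q ^ 2)) (q ^ 4) * entryLim a b q =
      qRisingInf (a ^ 2 * q) (q ^ 4) * qRisingInf (b ^ 2 * q) (q ^ 4) * entryLim 0 0 q := by
  have hq4 : ‖q ^ 4‖ < 1 := by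
    rw [norm_pow]; exact pow_lt_one₀ (norm_nonneg q) hq (by norm_num)
  have hL := ((tendsto_prod_qRisingInf (-(a * b)) hq4).mul
    (tendsto_prod_qRisingInf (-(a * b * q ^ 2)) hq4)).mul_const (entryLim a b q)
  have hR := ((tendsto_prod_qRisingInf (a ^ 2 * q) hq4).mul
    (tendsto_prod_qRisingInf (b ^ 2 * q) hq4)).mul (tendsto_entryLim hq hab)
  exact tendsto_nhds_unique (hL.congr (entryLim_iterate hq hab)) hR

end Recurrence

/-! ### The value of the continued fraction -/

theorem mainTheorem3 (a b q : ℂ) (hq : ‖q‖ < 1) (hab : ‖a * b‖ < 1) :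
    (qRisingInf (a ^ 2 * q ^ 3) (q ^ 4) * qRisingInf (b ^ 2 * q ^ 3) (q ^ 4) ≠ 0 ∨
      qRisingInf (a ^ 2 * q) (q ^ 4) * qRisingInf (b ^ 2 * q) (q ^ 4) ≠ 0) ∧
    CFConvergesTo (entryNum a b q) (entryDen a b q)
      (extDiv (qRisingInf (a ^ 2 * q ^ 3) (q ^ 4) * qRisingInf (b ^ 2 * q ^ 3) (q ^ 4))
        (qRisingInf (a ^ 2 * q) (q ^ 4) * qRisingInf (b ^ 2 * q) (q ^ 4))) := by
  have hne := products_ne_zero_or a b hq hab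
  refine ⟨hne, ?_⟩
  have hq4 : ‖q ^ 4‖ < 1 := by
    rw [norm_pow]; exact pow_lt_one₀ (norm_nonneg q) hq (by norm_num)
  obtain ⟨ℓ, hℓ⟩ := exists_tendsto_entryN hq hab
  have hD := (tendsto_entryD_and_entryLim_eq hq hab).1
  have hL0 := entryLim_zero_ne_zero hq
  have hκ₁ : qRisingInf (-(a * b)) (q ^ 4) ≠ 0 :=
    qRisingInf_ne_zero_of_norm_lt_one hq4 (by rwa [norm_neg])
  have hκ₂ : qRisingInf (-(a * b * q ^ 2)) (q ^ 4) ≠ 0 := by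
    refine qRisingInf_ne_zero_of_norm_lt_one hq4 ?_
    rw [norm_neg, show a * b * q ^ 2 = a * q * (b * q) by ring]
    exact norm_mul_lt_one_of_shift hq hab
  have hden := entryLim_eq hq hab
  have hnum : qRisingInf (-(a * b)) (q ^ 4) * qRisingInf (-(a * b * q ^ 2)) (q ^ 4) * ℓ =
      qRisingInf (a ^ 2 * q ^ 3) (q ^ 4) * qRisingInf (b ^ 2 * q ^ 3) (q ^ 4) *
        entryLim 0 0 q := by
    have h1 := entryLim_eq hq (norm_mul_lt_one_of_shift hq hab)
    rw [← entryN_limit hq hab hℓ] at h1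
    rw [show a * q * (b * q) = a * b * q ^ 2 by ring,
      show -(a * b * q ^ 2 * q ^ 2) = -(a * b) * q ^ 4 by ring,
      show (a * q) ^ 2 * q = a ^ 2 * q ^ 3 by ring,
      show (b * q) ^ 2 * q = b ^ 2 * q ^ 3 by ring] at h1
    rw [← h1, qRisingInf_eq_mul (-(a * b)) hq4]
    ring
  -- Both limits are the products of the theorem times the same nonzero factor.
  have hval : extDiv ℓ (entryLim a b q) =
      extDiv (qRisingInf (a ^ 2 * q ^ 3) (q ^ 4) * qRisingInf (b ^ 2 * q ^ 3) (q ^ 4))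
        (qRisingInf (a ^ 2 * q) (q ^ 4) * qRisingInf (b ^ 2 * q) (q ^ 4)) := by
    rw [← extDiv_mul_left (mul_ne_zero hκ₁ hκ₂), hnum, hden, mul_comm _ (entryLim 0 0 q),
      mul_comm _ (entryLim 0 0 q), extDiv_mul_left hL0]
  rw [← hval]
  refine cfConvergesTo_of_tendsto hℓ hD (hne.imp (fun h h0 => ?_) fun h h0 => ?_)
  · rw [h0, mul_zero] at hnum
    exact mul_ne_zero h hL0 hnum.symm
  · rw [h0, mul_zero] at hden
    exact mul_ne_zero h hL0 hden.symm
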